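/- For $m\ge 1$, real $\alpha_1,\dots,\alpha_m>0$, $\beta>0$ and $z_1,\dots,z_m\in\mathbb{C}$, the multinomial Mittag-Leffler function is defined by the convergent series \[ E_{(\alpha_1,\dots,\alpha_m),\beta}(z_1,\dots,z_m)=\sum_{k=0}^{\infty}\ \sum_{\substack{k_1+\dots+k_m=k\\ k_j\ge 0}}\binom{k}{k_1,\dots,k_m}\frac{\prod_{j=1}^m z_j^{k_j}}{\Gamma\bigl(\beta+\sum_{j=1}^m\alpha_jk_j\bigr)}, \] where $\binom{k}{k_1,\dots,k_m}$ is the multinomial coefficient. Let $m\ge 1$, $\beta>0$, $\alpha_1>\alpha_2>\dots>\alpha_m>0$ with $\alpha_1\in(0,2)$, let $\alpha_1\pi/2<\mu<\min\{\alpha_1\pi,\pi\}$ and let $K>0$. Then there exists a constant $C>0$, depending only on $\mu$, $K$, $\alpha_1,\dots,\alpha_m$ and $\beta$, such that for every $z_1\in\mathbb{C}\setminus\{0\}$ with $\mu\le|\arg(z_1)|\le\pi$ (principal argument) and all real $z_2,\dots,z_m$ with $-K\le z_j<0$ for $j=2,\dots,m$, the series defining $E_{(\alpha_1,\dots,\alpha_m),\beta}(z_1,\dots,z_m)$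 converges and \[ \bigl|E_{(\alpha_1,\dots,\alpha_m),\beta}(z_1,\dots,z_m)\bigr|\le\frac{C}{1+|z_1|}. \] -/

import Mathlib

noncomputable section

/-- The part of degree `k` of the multinomial Mittag-Leffler series: the sum over all
`κ = (κ_1, …, κ_n) ∈ ℕ^n` with `κ_1 + ⋯ + κ_n = k` of
`(k choose κ_1, …, κ_n) * ∏ z_j ^ κ_j / Γ(β + ∑ α_j κ_j)`. -/
def multinomialMLTerm {n : ℕ} (α : Fin n → ℝ) (β : ℝ) (z : Fin n → ℂ) (k : ℕ) : ℂ :=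
  ∑ κ ∈ Finset.piAntidiag (Finset.univ : Finset (Fin n)) k,
    (Nat.multinomial Finset.univ κ : ℂ) * (∏ j, z j ^ κ j) /
      (Real.Gamma (β + ∑ j, α j * (κ j : ℝ)) : ℂ)

/-- The multinomial Mittag-Leffler function `E_{(α_1, …, α_n), β}(z_1, …, z_n)`. -/
def multinomialML {n : ℕ} (α : Fin n → ℝ) (β : ℝ) (z : Fin n → ℂ) : ℂ :=
  ∑' k : ℕ, multinomialMLTerm α β z k

end

/-!
For `b > 0` the reciprocal Gamma function is an inverse Laplace transform,
`1 / Γ(b) = (2πi)⁻¹ ∫ exp s * s ^ (-b) ds` over a vertical line `Re s = c > 0`. Summing the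
multinomial series under the integral sign, with `S(s) = ∑ z_j s ^ (-α_j)`, gives
`E(z) = (2πi)⁻¹ ∫ exp s * F(s) ds`, where `F(s) = s ^ (-β) / (1 - S(s))`.

The classical proof bends the line into a Hankel contour, whose ends lie in `Re s < 0`. Here the
contour stays vertical and the decay at infinity comes from integrating by parts four times
instead: every function `g` multiplying `exp` is replaced by its fourth derivative, which leaves
the value unchanged because `exp` is its own derivative. No integration by parts is carried out;
two facts about these regularized integrals suffice.
* For `g = s ^ (-b)` the integral of the fourth derivative is `1 / Γ(b)`
  (`bromwich_iteratedDeriv_cpow_neg`), by Fourier inversion of `t ^ (b + 3) * exp (-c t)` and the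
  functional equation of `Γ`.
* If `g` is holomorphic with `|g(w)| ≤ A|s| ^ 2` on the discs `|w - s| ≤ ρ|s|`, then Cauchy's estimate
  bounds the fourth derivative by a multiple of `A|s| ^ (-2)`, which is integrable
  (`ControlledNear.norm_bromwich_le`).

On a line far to the right `|S| ≤ 1 / 2`, and the series telescopes with geometrically small
remainders (`exists_summable_multinomialML_eq`). To obtain constants independent of `z`, the line
is moved back to `Re s = 1` (`bromwich_eq_bromwich_one`). The discs around the points with
`Re s ≥ 1` are contained in a sector `|arg w| ≤ θ` with `θ > π / 2`, and `θ` can be chosen with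
`α_1 θ < μ`. On that sector the numbers `1`, `-z_1 w ^ (-α_1)` and `-z_j w ^ (-α_j)` for `j ≥ 2`, whose
sum is `1 - S(w)`, all lie in a common sector of opening less than `π`, so they do not cancel:
`|1 - S(w)| ≥ κ (1 + |z_1||w| ^ (-α_1))` (`le_norm_one_sub_mlSum`). As `α_1 < 2`, this bounds `F` by a
multiple of `|s| ^ 2 / (1 + |z_1|)`, and the factor `1 / (1 + |z_1|)` passes to the integral.
-/

open MeasureTheory Complex Filter Topology Set

/-! ### The Laplace transform of a power -/

theorem integrableOn_rpow_mul_exp_neg_mul {a r : ℝ} (ha : 0 < a) (hr : 0 < r) :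
    IntegrableOn (fun t : ℝ => t ^ (a - 1) * Real.exp (-(r * t))) (Ioi 0) := by
  have h := integrableOn_rpow_mul_exp_neg_mul_rpow (s := a - 1) (p := 1) (b := r)
    (by linarith) one_pos hr
  simpa [Real.rpow_one] using h

theorem norm_cpow_mul_exp_neg_mul {a t : ℝ} {p : ℂ} (ht : 0 < t) :
    ‖(t : ℂ) ^ ((a : ℂ) - 1) * cexp (-(p * t))‖ = t ^ (a - 1) * Real.exp (-(p.re * t)) := by
  rw [norm_mul, norm_cpow_eq_rpow_re_of_pos ht, norm_exp]
  simp

theorem continuousOn_cpow_mul_exp_neg_mul (a : ℝ) (p : ℂ) :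
    ContinuousOn (fun t : ℝ => (t : ℂ) ^ ((a : ℂ) - 1) * cexp (-(p * t))) (Ioi 0) := by
  intro t ht
  refine ContinuousAt.continuousWithinAt (ContinuousAt.mul ?_ (by fun_prop))
  exact (continuousAt_ofReal_cpow_const _ _ (Or.inr (ne_of_gt ht)))

theorem integrableOn_cpow_mul_exp_neg_mul {a : ℝ} {p : ℂ} (ha : 0 < a) (hp : 0 < p.re) :
    IntegrableOn (fun t : ℝ => (t : ℂ) ^ ((a : ℂ) - 1) * cexp (-(p * t))) (Ioi 0) := by
  refine Integrable.mono' (integrableOn_rpow_mul_exp_neg_mul ha hp)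
    ((continuousOn_cpow_mul_exp_neg_mul a p).aestronglyMeasurable measurableSet_Ioi) ?_
  filter_upwards [ae_restrict_mem measurableSet_Ioi] with t ht
  exact (norm_cpow_mul_exp_neg_mul ht).le

theorem differentiableAt_laplace_cpow {a : ℝ} {p : ℂ} (ha : 0 < a) (hp : 0 < p.re) :
    DifferentiableAt ℂ
      (fun p : ℂ => ∫ t in Ioi (0 : ℝ), (t : ℂ) ^ ((a : ℂ) - 1) * cexp (-(p * t))) p := by
  have key := hasDerivAt_integral_of_dominated_loc_of_deriv_le (μ := volume.restrict (Ioi (0 : ℝ)))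
    (F := fun (p : ℂ) (t : ℝ) => (t : ℂ) ^ ((a : ℂ) - 1) * cexp (-(p * t)))
    (F' := fun (p : ℂ) (t : ℝ) => (t : ℂ) ^ ((a : ℂ) - 1) * (cexp (-(p * t)) * (-t)))
    (x₀ := p) (s := {q : ℂ | p.re / 2 < q.re})
    (bound := fun t => t ^ (a + 1 - 1) * Real.exp (-(p.re / 2 * t))) ?_ ?_ ?_ ?_ ?_ ?_ ?_
  · exact key.2.differentiableAt
  · exact (isOpen_lt continuous_const continuous_re).mem_nhds (by simp; linarith)
  · exact Eventually.of_forall fun q =>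
      (continuousOn_cpow_mul_exp_neg_mul a q).aestronglyMeasurable measurableSet_Ioi
  · exact integrableOn_cpow_mul_exp_neg_mul ha hp
  · refine ContinuousOn.aestronglyMeasurable ?_ measurableSet_Ioi
    have : ContinuousOn (fun t : ℝ => ((t : ℂ) ^ ((a : ℂ) - 1) * cexp (-(p * t))) * (-t)) (Ioi 0) :=
      (continuousOn_cpow_mul_exp_neg_mul a p).mul (by fun_prop)
    simpa only [mul_assoc] using this
  · filter_upwards [ae_restrict_mem measurableSet_Ioi] with t ht q hq
    have ht : 0 < t := ht
    rw [← mul_assoc, norm_mul, norm_cpow_mul_exp_neg_mul ht, norm_neg, norm_real,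
      Real.norm_of_nonneg ht.le, mul_right_comm, add_sub_right_comm, Real.rpow_add_one ht.ne']
    have : p.re / 2 * t ≤ q.re * t := mul_le_mul_of_nonneg_right (le_of_lt hq) ht.le
    gcongr
  · exact integrableOn_rpow_mul_exp_neg_mul (by linarith) (by linarith)
  · refine Eventually.of_forall fun t q _ => ?_
    have h : HasDerivAt (fun q : ℂ => -(q * t)) (-(t : ℂ)) q :=
      (hasDerivAt_mul_const (t : ℂ)).neg
    exact h.cexp.const_mul _

/-- The Laplace transform of `t ^ (a - 1)` on the right half plane; obtained from the case of
real `p` by analytic continuation. -/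
theorem integral_cpow_mul_exp_neg_mul_Ioi_of_re_pos {a : ℝ} {p : ℂ} (ha : 0 < a) (hp : 0 < p.re) :
    ∫ t in Ioi (0 : ℝ), (t : ℂ) ^ ((a : ℂ) - 1) * cexp (-(p * t)) =
      p ^ (-(a : ℂ)) * Gamma a := by
  set U : Set ℂ := {q : ℂ | 0 < q.re} with hU
  have hUo : IsOpen U := isOpen_lt continuous_const continuous_re
  have h1 : AnalyticOnNhd ℂ
      (fun p : ℂ => ∫ t in Ioi (0 : ℝ), (t : ℂ) ^ ((a : ℂ) - 1) * cexp (-(p * t))) U :=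
    DifferentiableOn.analyticOnNhd
      (fun q hq => (differentiableAt_laplace_cpow ha hq).differentiableWithinAt) hUo
  have h2 : AnalyticOnNhd ℂ (fun p : ℂ => p ^ (-(a : ℂ)) * Gamma a) U := by
    refine DifferentiableOn.analyticOnNhd (fun q hq => ?_) hUo
    exact (((hasDerivAt_id q).cpow_const
      (Or.inl hq)).differentiableAt.mul_const _).differentiableWithinAt
  have hc : IsPreconnected U := (convex_halfSpace_re_gt 0).isPreconnected
  refine h1.eqOn_of_preconnected_of_frequently_eq h2 hc (z₀ := 1) (by simp [hU]) ?_ hp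
  have hmap : Tendsto (fun x : ℝ => (x : ℂ)) (𝓝[>] 1) (𝓝[≠] 1) := by
    refine tendsto_nhdsWithin_iff.2 ⟨?_, ?_⟩
    · exact (continuous_ofReal.tendsto' 1 1 (by simp)).mono_left nhdsWithin_le_nhds
    · filter_upwards [self_mem_nhdsWithin] with x hx
      simpa using ne_of_gt hx
  refine hmap.frequently (Eventually.frequently ?_)
  filter_upwards [self_mem_nhdsWithin] with x hx
  have hx0 : (0 : ℝ) < x := lt_trans one_pos hx
  rw [integral_cpow_mul_exp_neg_mul_Ioi (by simpa using ha) hx0, one_div, inv_cpow _ _ (by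
    rw [arg_ofReal_of_nonneg hx0.le]; exact Real.pi_pos.ne), cpow_neg]

/-! ### Bromwich integrals -/

/-- The inverse Laplace transform of `g` at time `1`, taken along the line `Re s = c`:
`(2πi)⁻¹ ∫ exp s * g s ds`, parametrized by `s = c + iy`. -/
noncomputable def bromwich (c : ℝ) (g : ℂ → ℂ) : ℂ :=
  (2 * Real.pi : ℂ)⁻¹ * ∫ y : ℝ, cexp (c + y * I) * g (c + y * I)

theorem one_add_sq_le_norm_sq {c : ℝ} (hc : 1 ≤ c) (y : ℝ) : 1 + y ^ 2 ≤ ‖(c + y * I : ℂ)‖ ^ 2 := by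
  rw [Complex.sq_norm, normSq_add_mul_I]
  nlinarith

theorem norm_exp_mul_le {A x : ℝ} {g : ℂ → ℂ} (hx : 1 ≤ x)
    (hA : ∀ s : ℂ, s.re = x → ‖g s‖ ≤ A / ‖s‖ ^ 2) (y : ℝ) :
    ‖cexp (x + y * I) * g (x + y * I)‖ ≤ Real.exp x * A * (1 + y ^ 2)⁻¹ := by
  have hs : (x + y * I : ℂ).re = x := by simp
  have h := one_add_sq_le_norm_sq hx y
  have hpos : 0 < ‖(x + y * I : ℂ)‖ ^ 2 := lt_of_lt_of_le (by positivity) h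
  have hA0 : 0 ≤ A := by
    have := (norm_nonneg _).trans (hA _ hs)
    by_contra! hneg
    exact absurd this (not_le.2 (div_neg_of_neg_of_pos hneg hpos))
  rw [norm_mul, norm_exp, mul_assoc, hs]
  gcongr
  refine (hA _ hs).trans ?_
  rw [div_eq_mul_inv]
  gcongr

theorem integrable_bromwich {c A : ℝ} {g : ℂ → ℂ} (hc : 1 ≤ c)
    (hg : ∀ s : ℂ, s.re = c → ContinuousAt g s) (hA : ∀ s : ℂ, s.re = c → ‖g s‖ ≤ A / ‖s‖ ^ 2) :
    Integrable fun y : ℝ => cexp (c + y * I) * g (c + y * I) := by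
  refine Integrable.mono' (integrable_inv_one_add_sq.const_mul (Real.exp c * A)) ?_
    (Eventually.of_forall (norm_exp_mul_le hc hA))
  refine Continuous.aestronglyMeasurable (Continuous.mul (by fun_prop) ?_)
  refine continuous_iff_continuousAt.2 fun y => ?_
  exact ContinuousAt.comp (f := fun y : ℝ => (c + y * I : ℂ)) (hg _ (by simp)) (by fun_prop)

theorem norm_bromwich_le {c A : ℝ} {g : ℂ → ℂ} (hc : 1 ≤ c)
    (hA : ∀ s : ℂ, s.re = c → ‖g s‖ ≤ A / ‖s‖ ^ 2) :
    ‖bromwich c g‖ ≤ Real.exp c * A / 2 := by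
  have h := norm_integral_le_of_norm_le (integrable_inv_one_add_sq.const_mul (Real.exp c * A))
    (Eventually.of_forall (norm_exp_mul_le hc hA))
  rw [integral_const_mul, integral_univ_inv_one_add_sq] at h
  have hn : ‖(2 * Real.pi : ℂ)⁻¹‖ = (2 * Real.pi)⁻¹ := by
    simp [abs_of_pos Real.pi_pos]
  rw [bromwich, norm_mul, hn]
  calc _ ≤ (2 * Real.pi)⁻¹ * (Real.exp c * A * Real.pi) := by gcongr
    _ = _ := by field_simp

/-- The line of integration may be moved: the horizontal sides of the rectangles with vertices
`1 ± iT`, `c ± iT` contribute `O(T ^ (-2))`. -/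
theorem bromwich_eq_bromwich_one {c A : ℝ} {g : ℂ → ℂ} (hc : 1 ≤ c)
    (hg : ∀ s : ℂ, 1 ≤ s.re → DifferentiableAt ℂ g s) (hA : ∀ s : ℂ, 1 ≤ s.re → ‖g s‖ ≤ A / ‖s‖ ^ 2) :
    bromwich c g = bromwich 1 g := by
  have hlim (x : ℝ) (hx : 1 ≤ x) :=
    intervalIntegral_tendsto_integral (integrable_bromwich hx
      (fun s hs => (hg s (hs.symm ▸ hx)).continuousAt) fun s hs => hA s (hs.symm ▸ hx))
      tendsto_neg_atTop_atBot tendsto_id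
  have hdiff := (hlim c hc).sub (hlim 1 le_rfl)
  have hside (T : ℝ) : ‖∫ x in (1 : ℝ)..c, cexp (x + T * I) * g (x + T * I)‖ ≤
      Real.exp c * A * (1 + T ^ 2)⁻¹ * |c - 1| := by
    refine intervalIntegral.norm_integral_le_of_norm_le_const fun x hx => ?_
    rw [uIoc_of_le hc] at hx
    have hA0 : 0 ≤ A := by
      have := (norm_nonneg _).trans (hA 1 (by simp))
      simpa using this
    refine (norm_exp_mul_le hx.1.le (fun s hs => hA s (hs.symm ▸ hx.1.le)) T).trans ?_
    have := hx.2
    gcongr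
  have hzero : Tendsto (fun T : ℝ => (∫ y in -T..id T, cexp (c + y * I) * g (c + y * I)) -
      ∫ y in -T..id T, cexp ((1 : ℝ) + y * I) * g ((1 : ℝ) + y * I)) atTop (𝓝 0) := by
    have hb : Tendsto (fun T : ℝ => 2 * (Real.exp c * A * (1 + T ^ 2)⁻¹ * |c - 1|)) atTop
        (𝓝 0) := by
      have h1 : Tendsto (fun T : ℝ => (1 + T ^ 2)⁻¹) atTop (𝓝 0) :=
        tendsto_inv_atTop_zero.comp
          (tendsto_atTop_add_const_left _ _ (tendsto_pow_atTop two_ne_zero))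
      simpa using ((h1.const_mul (Real.exp c * A)).mul_const |c - 1|).const_mul 2
    refine squeeze_zero_norm (fun T => ?_) hb
    have hrect := integral_boundary_rect_eq_zero_of_differentiableOn
      (fun s => cexp s * g s) (1 + (-T : ℝ) * I) (c + T * I) ?_
    · simp only [add_re, one_re, mul_re, ofReal_re, I_re, I_im, ofReal_im, mul_zero, mul_one,
        sub_zero, add_zero, add_im, one_im, mul_im, zero_add, smul_eq_mul] at hrect
      have h3 : I * ((∫ y in -T..T, cexp (c + y * I) * g (c + y * I)) -
          ∫ y in -T..T, cexp ((1 : ℝ) + y * I) * g ((1 : ℝ) + y * I)) =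
          (∫ x in (1 : ℝ)..c, cexp (x + T * I) * g (x + T * I)) -
          ∫ x in (1 : ℝ)..c, cexp (x + (-T : ℝ) * I) * g (x + (-T : ℝ) * I) := by
        linear_combination hrect
      have h4 := congrArg norm h3
      rw [norm_mul, norm_I, one_mul] at h4
      rw [id, h4]
      have h5 := hside T
      have h6 := hside (-T)
      rw [neg_sq] at h6
      exact (norm_sub_le _ _).trans (by linarith)
    · refine (differentiable_exp.differentiableOn).mul fun s hs =>
        (hg s ?_).differentiableWithinAt
      have hs := hs.1
      simp only [add_re, one_re, mul_re, ofReal_re, I_re, I_im, ofReal_im, mul_zero, mul_one,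
        sub_zero, add_zero, mem_preimage, uIcc_of_le hc] at hs
      exact hs.1
  have := tendsto_nhds_unique hdiff hzero
  rw [bromwich, bromwich, sub_eq_zero.1 this]

/-- Fourier inversion at time `1` for `t ^ (a - 1) * exp (-c t)` on `t > 0`. The hypothesis `2 ≤ a`
makes the integral over the line absolutely convergent. -/
theorem bromwich_cpow_neg {a c : ℝ} (ha : 2 ≤ a) (hc : 1 ≤ c) :
    bromwich c (fun s => s ^ (-(a : ℂ))) = (Real.Gamma a : ℂ)⁻¹ := by
  have ha0 : 0 < a := by linarith
  set f : ℝ → ℂ := indicator (Ioi 0) fun t : ℝ => (t : ℂ) ^ ((a : ℂ) - 1) * cexp (-((c : ℂ) * t))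
    with hf
  have hfi : Integrable f := by
    rw [hf, integrable_indicator_iff measurableSet_Ioi]
    exact integrableOn_cpow_mul_exp_neg_mul ha0 (by simp; linarith)
  have hF : FourierTransform.fourier f =
      fun ξ : ℝ => (c + (2 * Real.pi * ξ : ℝ) * I : ℂ) ^ (-(a : ℂ)) * Gamma a := by
    ext ξ
    rw [Real.fourier_real_eq_integral_exp_smul,
      ← integral_cpow_mul_exp_neg_mul_Ioi_of_re_pos ha0 (by simp; linarith),
      ← integral_indicator measurableSet_Ioi]
    congr 1 with t
    by_cases ht : t ∈ Ioi (0 : ℝ)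
    · simp only [hf, indicator_of_mem ht, smul_eq_mul]
      rw [mul_left_comm, ← Complex.exp_add]
      congr 2
      push_cast
      ring
    · simp only [hf, indicator_of_notMem ht, smul_zero]
  have hcont : Continuous fun y : ℝ => (c + y * I : ℂ) ^ (-(a : ℂ)) := by
    refine Continuous.cpow (by fun_prop) continuous_const fun y => Or.inl ?_
    simp; linarith
  have hint : Integrable fun y : ℝ => (c + y * I : ℂ) ^ (-(a : ℂ)) := by
    refine Integrable.mono' integrable_inv_one_add_sq hcont.aestronglyMeasurable
      (Eventually.of_forall fun y => ?_)
    have h1 := one_add_sq_le_norm_sq hc y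
    have h2 : 1 ≤ ‖(c + y * I : ℂ)‖ := by nlinarith [norm_nonneg (c + y * I : ℂ)]
    rw [← ofReal_neg, norm_cpow_real]
    calc _ ≤ ‖(c + y * I : ℂ)‖ ^ (-2 : ℝ) := Real.rpow_le_rpow_of_exponent_le h2 (by linarith)
      _ = (‖(c + y * I : ℂ)‖ ^ 2)⁻¹ := by
        rw [Real.rpow_neg (norm_nonneg _)]; norm_num
      _ ≤ _ := by gcongr
  have hFi : Integrable (FourierTransform.fourier f) := by
    rw [hF]
    exact (hint.comp_mul_left' (R := 2 * Real.pi) (by positivity)).mul_const _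
  have hfc : ContinuousAt f 1 := by
    have h : f =ᶠ[𝓝 1] fun t : ℝ => (t : ℂ) ^ ((a : ℂ) - 1) * cexp (-((c : ℂ) * t)) := by
      filter_upwards [Ioi_mem_nhds (zero_lt_one (α := ℝ))] with t ht
      simp only [hf, indicator_of_mem ht]
    refine ContinuousAt.congr ?_ h.symm
    exact (continuousOn_cpow_mul_exp_neg_mul a c).continuousAt (Ioi_mem_nhds (zero_lt_one (α := ℝ)))
  have key := hfi.fourierInv_fourier_eq hFi hfc
  have hf1 : f 1 = cexp (-c) := by
    simp only [hf, indicator_of_mem (show (1 : ℝ) ∈ Ioi (0 : ℝ) from zero_lt_one (α := ℝ))]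
    simp
  rw [hF, hf1, Real.fourierInv_eq'] at key
  have hsub := Measure.integral_comp_mul_left
    (fun y : ℝ => cexp (y * I) * ((c + y * I : ℂ) ^ (-(a : ℂ)) * Gamma a)) (2 * Real.pi)
  have hG : (Real.Gamma a : ℂ) ≠ 0 := by
    exact_mod_cast (Real.Gamma_pos_of_pos ha0).ne'
  have hkey2 : (2 * Real.pi : ℂ)⁻¹ * ∫ y : ℝ, cexp (y * I) *
      ((c + y * I : ℂ) ^ (-(a : ℂ)) * Gamma a) = cexp (-c) := by
    rw [← key]
    have h2 : |(2 * Real.pi)⁻¹| = (2 * Real.pi)⁻¹ := abs_of_pos (by positivity)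
    rw [h2, real_smul] at hsub
    push_cast at hsub
    rw [← hsub]
    congr 1 with ξ
    simp [mul_comm, mul_left_comm]
  unfold bromwich
  refine eq_inv_of_mul_eq_one_left ?_
  rw [← Gamma_ofReal, mul_assoc, ← integral_mul_const]
  have : ∀ y : ℝ, cexp (c + y * I) * (c + y * I : ℂ) ^ (-(a : ℂ)) * Gamma a =
      cexp c * (cexp (y * I) * ((c + y * I : ℂ) ^ (-(a : ℂ)) * Gamma a)) := by
    intro y; rw [Complex.exp_add]; ring
  simp_rw [this]
  rw [integral_const_mul, mul_left_comm, hkey2, ← Complex.exp_add]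
  simp

/-! ### The reciprocal Gamma function -/

theorem iteratedDeriv_cpow_const (n : ℕ) (c : ℂ) {s : ℂ} (hs : s ∈ slitPlane) :
    iteratedDeriv n (fun s : ℂ => s ^ c) s = (∏ i ∈ Finset.range n, (c - i)) * s ^ (c - n) := by
  induction n generalizing s with
  | zero => simp
  | succ n ih =>
    have h : iteratedDeriv n (fun s : ℂ => s ^ c) =ᶠ[𝓝 s]
        fun s => (∏ i ∈ Finset.range n, (c - i)) * s ^ (c - n) := by
      filter_upwards [isOpen_slitPlane.mem_nhds hs] with w hw using ih hw
    have hd : HasDerivAt (fun s : ℂ => s ^ (c - n)) ((c - n) * s ^ (c - n - 1)) s := by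
      simpa using (hasDerivAt_id' s).cpow_const (c := c - n) hs
    rw [iteratedDeriv_succ, h.deriv_eq, (hd.const_mul _).deriv, Finset.prod_range_succ]
    push_cast
    rw [sub_sub, mul_assoc]

/-- The reciprocal Gamma function as a Bromwich integral. Differentiating `s ^ (-b)` four times
makes the integral absolutely convergent for every `b > 0`, and the factor
`b (b + 1) (b + 2) (b + 3)` is absorbed by the functional equation of `Γ`. -/
theorem bromwich_iteratedDeriv_cpow_neg {b c : ℝ} (hb : 0 < b) (hc : 1 ≤ c) :
    bromwich c (iteratedDeriv 4 fun s : ℂ => s ^ (-(b : ℂ))) = (Real.Gamma b : ℂ)⁻¹ := by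
  have h1 := bromwich_cpow_neg (a := b + 4) (by linarith) hc
  have h2 : bromwich c (iteratedDeriv 4 fun s : ℂ => s ^ (-(b : ℂ))) =
      (b * (b + 1) * (b + 2) * (b + 3)) * bromwich c fun s => s ^ (-((b + 4 : ℝ) : ℂ)) := by
    rw [bromwich, bromwich, mul_left_comm]
    congr 1
    rw [← integral_const_mul]
    refine integral_congr_ae (Eventually.of_forall fun y => ?_)
    have hs : (c + y * I : ℂ) ∈ slitPlane := Or.inl (by simp; linarith)
    simp only [iteratedDeriv_cpow_const 4 _ hs]
    have : -(b : ℂ) - (4 : ℕ) = -((b + 4 : ℝ) : ℂ) := by push_cast; ring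
    rw [this]
    simp only [Finset.prod_range_succ, Finset.prod_range_zero]
    push_cast
    ring
  have h3 : Real.Gamma (b + 4) = (b + 3) * ((b + 2) * ((b + 1) * (b * Real.Gamma b))) := by
    rw [show b + 4 = b + 3 + 1 by ring, Real.Gamma_add_one (by linarith),
      show b + 3 = b + 2 + 1 by ring, Real.Gamma_add_one (by linarith),
      show b + 2 = b + 1 + 1 by ring, Real.Gamma_add_one (by linarith),
      Real.Gamma_add_one (by linarith)]
  have hG := Real.Gamma_pos_of_pos hb
  rw [h2, h1, h3, ← ofReal_inv, ← ofReal_inv]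
  norm_cast
  field_simp

/-! ### Cauchy's estimate on discs in a sector -/

/-- Cauchy's estimate on a disc of radius `ρ|s|`: four derivatives gain a factor `|s| ^ (-4)`. -/
theorem norm_iteratedDeriv_four_le {f : ℂ → ℂ} {s : ℂ} {ρ A : ℝ} (hρ : 0 < ρ) (hs : s ≠ 0)
    (hf : ∀ w ∈ Metric.closedBall s (ρ * ‖s‖), DifferentiableAt ℂ f w)
    (hA : ∀ w ∈ Metric.closedBall s (ρ * ‖s‖), ‖f w‖ ≤ A * ‖s‖ ^ 2) :
    ‖iteratedDeriv 4 f s‖ ≤ 24 * A / ρ ^ 4 / ‖s‖ ^ 2 := by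
  have hs' : 0 < ‖s‖ := norm_pos_iff.2 hs
  have hd : DiffContOnCl ℂ f (Metric.ball s (ρ * ‖s‖)) := by
    refine DifferentiableOn.diffContOnCl fun w hw => ?_
    exact (hf w (Metric.closure_ball_subset_closedBall hw)).differentiableWithinAt
  have h := norm_iteratedDeriv_le_of_forall_mem_sphere_norm_le 4 (by positivity) hd
    fun w hw => hA w (Metric.sphere_subset_closedBall hw)
  refine h.trans (le_of_eq ?_)
  rw [show (Nat.factorial 4 : ℝ) = 24 by norm_num [Nat.factorial]]
  field_simp

/-- Discs around points of the half plane `Re s > 0` whose radius is a small multiple of `‖s‖`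
stay in the sector `|arg w| ≤ θ`, as `θ > π / 2`. -/
theorem abs_arg_le_of_mem_closedBall {θ ρ : ℝ} (hθ0 : 0 ≤ θ) (hρ : 0 < ρ)
    (hρ2 : ρ ≤ 1 / 2) (hρθ : 2 * ρ ≤ -Real.cos θ) {s w : ℂ} (hs : 0 < s.re)
    (hw : w ∈ Metric.closedBall s (ρ * ‖s‖)) :
    |arg w| ≤ θ ∧ ‖s‖ / 2 ≤ ‖w‖ ∧ ‖w‖ ≤ 2 * ‖s‖ := by
  rw [mem_closedBall_iff_norm] at hw
  have hs0 : 0 < ‖s‖ := norm_pos_iff.2 fun h => by simp [h] at hs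
  have h1 : ‖s‖ - ‖w‖ ≤ ‖w - s‖ := by rw [norm_sub_rev]; exact norm_sub_norm_le _ _
  have h2 : ‖w‖ - ‖s‖ ≤ ‖w - s‖ := norm_sub_norm_le _ _
  have h3 : ρ * ‖s‖ ≤ 1 / 2 * ‖s‖ := by gcongr
  have h4 : ‖s‖ / 2 ≤ ‖w‖ := by linarith
  refine ⟨?_, h4, by linarith⟩
  have hw0 : 0 < ‖w‖ := by linarith
  have h5 : -(ρ * ‖s‖) ≤ w.re := by
    have := (abs_le.1 (abs_re_le_norm (w - s))).1
    rw [sub_re] at this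
    linarith
  have h6 : Real.cos θ * ‖w‖ ≤ w.re := by
    have : ρ * ‖s‖ ≤ ρ * (2 * ‖w‖) := by gcongr; linarith
    nlinarith
  by_contra! hlt
  have h7 := Real.cos_lt_cos_of_nonneg_of_le_pi hθ0 (abs_arg_le_pi w) hlt
  rw [Real.cos_abs, cos_arg (norm_pos_iff.1 hw0), div_lt_iff₀ hw0] at h7
  linarith

/-! ### The lower bound for the denominator -/

/-- If `|A| ≤ a < μ < π` and `|η| ≤ π - μ`, then the angles `0`, `-A` and `η - A` lie in an interval
of length `π - (μ - a)`; rotating by `ψ` moves its midpoint to `0`. -/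
theorem exists_rotation {A η a μ : ℝ} (hA : |A| ≤ a) (hη : |η| ≤ Real.pi - μ) (hμ : μ < Real.pi) :
    ∃ ψ : ℝ, |ψ| ≤ (Real.pi - (μ - a)) / 2 ∧ |ψ - A| ≤ (Real.pi - (μ - a)) / 2 ∧
      |ψ + η - A| ≤ (Real.pi - (μ - a)) / 2 := by
  simp only [abs_le] at *
  obtain ⟨hA1, hA2⟩ := hA
  obtain ⟨hη1, hη2⟩ := hη
  rcases le_total 0 A with h0 | h0 <;> rcases le_total 0 η with h1 | h1
  · rcases le_total η A with h2 | h2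
    · exact ⟨A / 2, by constructor <;> linarith, by constructor <;> linarith,
        by constructor <;> linarith⟩
    · exact ⟨A - η / 2, by constructor <;> linarith, by constructor <;> linarith,
        by constructor <;> linarith⟩
  · exact ⟨(A - η) / 2, by constructor <;> linarith, by constructor <;> linarith,
      by constructor <;> linarith⟩
  · exact ⟨(A - η) / 2, by constructor <;> linarith, by constructor <;> linarith,
      by constructor <;> linarith⟩
  · rcases le_total A η with h2 | h2
    · exact ⟨A / 2, by constructor <;> linarith, by constructor <;> linarith,
        by constructor <;> linarith⟩
    · exact ⟨A - η / 2, by constructor <;> linarith, by constructor <;> linarith,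
        by constructor <;> linarith⟩

/-- The sum `∑ z_j s ^ (-α_j)`. The Laplace transform of
`t ^ (β - 1) E(z_1 t ^ α_1, …, z_n t ^ α_n)` is `s ^ (-β) / (1 - mlSum α z s)`. -/
noncomputable def mlSum {n : ℕ} (α : Fin n → ℝ) (z : Fin n → ℂ) (s : ℂ) : ℂ :=
  ∑ j, z j * s ^ (-(α j : ℂ))

theorem cpow_neg_ofReal (w : ℂ) (a : ℝ) :
    w ^ (-(a : ℂ)) = (‖w‖ ^ (-a) : ℝ) * cexp ((-(a * arg w) : ℝ) * I) := by
  rw [← ofReal_neg, cpow_ofReal, exp_mul_I, ofReal_cos, ofReal_sin]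
  congr 3 <;> ring_nf

theorem norm_cpow_neg_ofReal (w : ℂ) (a : ℝ) : ‖w ^ (-(a : ℂ))‖ = ‖w‖ ^ (-a) := by
  rw [← ofReal_neg, norm_cpow_real]

theorem re_exp_mul (ψ r η : ℝ) :
    (cexp (ψ * I) * (r * cexp (η * I))).re = r * Real.cos (ψ + η) := by
  rw [mul_left_comm, ← Complex.exp_add, ← add_mul, ← ofReal_add, re_ofReal_mul, exp_ofReal_mul_I_re]

/-- If the argument of `z` is at least `μ` in absolute value, that of `-z` is at most `π - μ`. -/
theorem exists_neg_eq_norm_mul_exp {z : ℂ} {μ : ℝ} (hz : μ ≤ |arg z|) :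
    ∃ η : ℝ, |η| ≤ Real.pi - μ ∧ -z = ‖z‖ * cexp (η * I) := by
  have hz' := norm_mul_exp_arg_mul_I z
  have h1 := arg_le_pi z
  have h2 := neg_pi_lt_arg z
  rcases le_abs.1 hz with h | h
  · refine ⟨arg z - Real.pi, abs_le.2 ⟨by linarith, by linarith⟩, ?_⟩
    rw [ofReal_sub, sub_mul, exp_sub_pi_mul_I, mul_neg, hz']
  · refine ⟨arg z + Real.pi, abs_le.2 ⟨by linarith, by linarith⟩, ?_⟩
    rw [ofReal_add, add_mul, exp_add_pi_mul_I, mul_neg, hz']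

/-- After a suitable rotation all summands `1`, `-z_j s ^ (-α_j)` of
`1 - mlSum α z s` lie in one sector
around the positive axis of half-angle less than `π / 2`, so no cancellation occurs. -/
theorem le_norm_one_sub_mlSum {m : ℕ} {α : Fin (m + 1) → ℝ} {z : Fin (m + 1) → ℂ} {θ μ : ℝ}
    (hα_le : ∀ j, α j ≤ α 0) (hα_pos : ∀ j, 0 < α j) (hθμ : α 0 * θ < μ) (hμ : μ < Real.pi)
    (hz0 : μ ≤ |arg (z 0)|) (hz : ∀ j, j ≠ 0 → ∃ x : ℝ, z j = x ∧ x < 0) {w : ℂ}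
    (hw : |arg w| ≤ θ) :
    Real.cos ((Real.pi - (μ - α 0 * θ)) / 2) * (1 + ‖z 0‖ * ‖w‖ ^ (-α 0)) ≤
      ‖1 - mlSum α z w‖ := by
  have hθ : 0 ≤ θ := (abs_nonneg _).trans hw
  obtain ⟨η, hη, hzη⟩ := exists_neg_eq_norm_mul_exp hz0
  have hA : |α 0 * arg w| ≤ α 0 * θ := by
    rw [abs_mul, abs_of_pos (hα_pos 0)]
    exact mul_le_mul_of_nonneg_left hw (hα_pos 0).le
  obtain ⟨ψ, h1, h2, h3⟩ := exists_rotation hA hη hμ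
  set h := (Real.pi - (μ - α 0 * θ)) / 2 with hh
  have hπ : h ≤ Real.pi := by linarith [Real.pi_pos]
  have hcos {x : ℝ} (hx : |x| ≤ h) : Real.cos h ≤ Real.cos x := by
    rw [← Real.cos_abs x]
    exact Real.cos_le_cos_of_nonneg_of_le_pi (abs_nonneg x) hπ hx
  have hcos0 : 0 ≤ Real.cos h :=
    Real.cos_nonneg_of_neg_pi_div_two_le_of_le
      (by linarith [Real.pi_pos, (abs_nonneg ψ).trans h1]) (by linarith)
  have hone : Real.cos h ≤ (cexp (ψ * I)).re := by
    rw [exp_ofReal_mul_I_re]; exact hcos h1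
  have hzero : Real.cos h * (‖z 0‖ * ‖w‖ ^ (-α 0)) ≤
      (cexp (ψ * I) * (-(z 0) * w ^ (-(α 0 : ℂ)))).re := by
    have : -(z 0) * w ^ (-(α 0 : ℂ)) =
        ((‖z 0‖ * ‖w‖ ^ (-α 0) : ℝ) : ℂ) * cexp ((η - α 0 * arg w : ℝ) * I) := by
      rw [hzη, cpow_neg_ofReal, sub_eq_add_neg, ofReal_add, add_mul, Complex.exp_add]
      push_cast
      ring
    rw [this, re_exp_mul, mul_comm]
    refine mul_le_mul_of_nonneg_left (hcos ?_) (by positivity)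
    rwa [← add_sub_assoc]
  have hother (j : Fin m) : 0 ≤ (cexp (ψ * I) * (-(z j.succ) * w ^ (-(α j.succ : ℂ)))).re := by
    obtain ⟨x, hx, hx0⟩ := hz j.succ (Fin.succ_ne_zero j)
    have : -(z j.succ) * w ^ (-(α j.succ : ℂ)) =
        ((-x * ‖w‖ ^ (-α j.succ) : ℝ) : ℂ) * cexp ((-(α j.succ * arg w) : ℝ) * I) := by
      rw [hx, cpow_neg_ofReal]
      push_cast
      ring
    rw [this, re_exp_mul]
    refine mul_nonneg (mul_nonneg (by linarith) (by positivity)) (hcos0.trans (hcos ?_))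
    -- `α j * arg w` lies between `0` and `α 0 * arg w`
    have ha := hα_le j.succ
    have hb := hα_pos j.succ
    rw [abs_le] at h1 h2 ⊢
    rcases le_total 0 (arg w) with h0 | h0
    · constructor <;> nlinarith
    · constructor <;> nlinarith
  have hre : (cexp (ψ * I) * (1 - mlSum α z w)).re = (cexp (ψ * I)).re +
      ((cexp (ψ * I) * (-(z 0) * w ^ (-(α 0 : ℂ)))).re +
        ∑ j : Fin m, (cexp (ψ * I) * (-(z j.succ) * w ^ (-(α j.succ : ℂ)))).re) := by
    rw [mlSum, Fin.sum_univ_succ, ← re_sum, ← add_re, ← add_re, ← Finset.mul_sum]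
    simp only [neg_mul, Finset.sum_neg_distrib]
    congr 1
    ring
  calc _ ≤ (cexp (ψ * I) * (1 - mlSum α z w)).re := by
        rw [hre]
        have := Finset.sum_nonneg fun j (_ : j ∈ Finset.univ) => hother j
        linarith
    _ ≤ ‖cexp (ψ * I) * (1 - mlSum α z w)‖ := re_le_norm _
    _ = _ := by rw [norm_mul, norm_exp_ofReal_mul_I, one_mul]

/-! ### Functions of quadratic growth near a half plane -/

/-- `f` is holomorphic on the discs `|w - s| ≤ ρ|s|` for `Re s ≥ c`, with `|f w| ≤ A|s| ^ 2` there.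
The growth allowed is what four derivatives turn into the integrable decay `|s| ^ (-2)`. -/
def ControlledNear (ρ c A : ℝ) (f : ℂ → ℂ) : Prop :=
  ∀ s : ℂ, c ≤ s.re → ∀ w ∈ Metric.closedBall s (ρ * ‖s‖),
    DifferentiableAt ℂ f w ∧ ‖f w‖ ≤ A * ‖s‖ ^ 2

theorem ne_zero_of_le_re {c : ℝ} {s : ℂ} (hc : 1 ≤ c) (hs : c ≤ s.re) : s ≠ 0 := by
  rintro rfl
  rw [zero_re] at hs
  linarith

namespace ControlledNear

variable {ρ c A : ℝ} {f : ℂ → ℂ}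

theorem analyticAt (h : ControlledNear ρ c A f) (hρ : 0 < ρ) (hc : 1 ≤ c) {s : ℂ}
    (hs : c ≤ s.re) : AnalyticAt ℂ f s := by
  rw [analyticAt_iff_eventually_differentiableAt]
  have : 0 < ρ * ‖s‖ := mul_pos hρ (norm_pos_iff.2 (ne_zero_of_le_re hc hs))
  filter_upwards [Metric.closedBall_mem_nhds s this] with w hw using (h s hs w hw).1

theorem norm_iteratedDeriv_le (h : ControlledNear ρ c A f) (hρ : 0 < ρ) (hc : 1 ≤ c) {s : ℂ}
    (hs : c ≤ s.re) : ‖iteratedDeriv 4 f s‖ ≤ 24 * A / ρ ^ 4 / ‖s‖ ^ 2 :=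
  norm_iteratedDeriv_four_le hρ (ne_zero_of_le_re hc hs) (fun w hw => (h s hs w hw).1)
    fun w hw => (h s hs w hw).2

theorem differentiableAt_iteratedDeriv (h : ControlledNear ρ c A f) (hρ : 0 < ρ) (hc : 1 ≤ c)
    {s : ℂ} (hs : c ≤ s.re) : DifferentiableAt ℂ (iteratedDeriv 4 f) s := by
  rw [iteratedDeriv_eq_iterate]
  exact ((h.analyticAt hρ hc hs).iterated_deriv 4).differentiableAt

theorem integrable (h : ControlledNear ρ c A f) (hρ : 0 < ρ) (hc : 1 ≤ c) :
    Integrable fun y : ℝ => cexp (c + y * I) * iteratedDeriv 4 f (c + y * I) :=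
  integrable_bromwich hc
    (fun _ hs => (h.differentiableAt_iteratedDeriv hρ hc hs.ge).continuousAt)
    fun _ hs => h.norm_iteratedDeriv_le hρ hc hs.ge

theorem norm_bromwich_le (h : ControlledNear ρ c A f) (hρ : 0 < ρ) (hc : 1 ≤ c) :
    ‖bromwich c (iteratedDeriv 4 f)‖ ≤ Real.exp c * (24 * A / ρ ^ 4) / 2 :=
  _root_.norm_bromwich_le hc fun _ hs => h.norm_iteratedDeriv_le hρ hc hs.ge

theorem bromwich_eq_bromwich_one (h : ControlledNear ρ 1 A f) (hρ : 0 < ρ) (hc : 1 ≤ c) :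
    bromwich c (iteratedDeriv 4 f) = bromwich 1 (iteratedDeriv 4 f) :=
  _root_.bromwich_eq_bromwich_one hc
    (fun _ hs => h.differentiableAt_iteratedDeriv hρ le_rfl hs)
    fun _ hs => h.norm_iteratedDeriv_le hρ le_rfl hs

theorem bromwich_sub {B : ℝ} {g u : ℂ → ℂ} (hf : ControlledNear ρ c A f)
    (hg : ControlledNear ρ c B g) (hρ : 0 < ρ) (hc : 1 ≤ c)
    (hu : ∀ s : ℂ, s.re = c → u =ᶠ[𝓝 s] f - g) :
    bromwich c (iteratedDeriv 4 u) =
      bromwich c (iteratedDeriv 4 f) - bromwich c (iteratedDeriv 4 g) := by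
  rw [bromwich, bromwich, bromwich, ← mul_sub, ← integral_sub (hf.integrable hρ hc)
    (hg.integrable hρ hc)]
  congr 1
  refine integral_congr_ae (Eventually.of_forall fun y => ?_)
  have hs : (c + y * I : ℂ).re = c := by simp
  simp only [(hu _ hs).iteratedDeriv_eq 4]
  rw [iteratedDeriv_sub (hf.analyticAt hρ hc hs.ge).contDiffAt
    (hg.analyticAt hρ hc hs.ge).contDiffAt, mul_sub]

end ControlledNear

/-! ### The multinomial series as a Bromwich integral -/

theorem cpow_neg_mul_mlSum_pow {n : ℕ} (α : Fin n → ℝ) (β : ℝ) (z : Fin n → ℂ) (k : ℕ) {s : ℂ}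
    (hs : s ≠ 0) :
    s ^ (-(β : ℂ)) * mlSum α z s ^ k =
      ∑ κ ∈ Finset.piAntidiag (Finset.univ : Finset (Fin n)) k,
        ((Nat.multinomial Finset.univ κ : ℂ) * ∏ j, z j ^ κ j) *
          s ^ (-((β + ∑ j, α j * (κ j : ℝ) : ℝ) : ℂ)) := by
  rw [mlSum, Finset.sum_pow_eq_sum_piAntidiag, Finset.mul_sum]
  refine Finset.sum_congr rfl fun κ _ => ?_
  have h : s ^ (-((β + ∑ j, α j * (κ j : ℝ) : ℝ) : ℂ)) =
      s ^ (-(β : ℂ)) * ∏ j, (s ^ (-(α j : ℂ))) ^ κ j := by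
    simp only [cpow_def_of_ne_zero hs, ← Complex.exp_nat_mul, ← Complex.exp_sum,
      ← Complex.exp_add]
    congr 1
    push_cast
    rw [neg_add, mul_add, ← Finset.sum_neg_distrib, Finset.mul_sum]
    congr 1
    exact Finset.sum_congr rfl fun j _ => by ring
  simp only [mul_pow, Finset.prod_mul_distrib]
  rw [h]
  ring

theorem integrable_iteratedDeriv_cpow_neg {b c : ℝ} (hb : 0 < b) (hc : 1 ≤ c) :
    Integrable fun y : ℝ =>
      cexp (c + y * I) * iteratedDeriv 4 (fun s : ℂ => s ^ (-(b : ℂ))) (c + y * I) := by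
  have hmem {s : ℂ} (hs : s.re = c) : s ∈ slitPlane := Or.inl (by linarith)
  refine integrable_bromwich (A := ‖∏ i ∈ Finset.range 4, (-(b : ℂ) - i)‖) hc (fun s hs => ?_)
    fun s hs => ?_
  · rw [iteratedDeriv_eq_iterate]
    refine (AnalyticAt.iterated_deriv ?_ 4).continuousAt
    exact analyticAt_id.cpow analyticAt_const (hmem hs)
  · have h1 : 1 ≤ ‖s‖ := by linarith [re_le_norm s]
    rw [iteratedDeriv_cpow_const 4 _ (hmem hs), norm_mul, div_eq_mul_inv]
    gcongr
    rw [show -(b : ℂ) - (4 : ℕ) = ((-b - 4 : ℝ) : ℂ) by push_cast; ring, norm_cpow_real]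
    calc _ ≤ ‖s‖ ^ (-2 : ℝ) := Real.rpow_le_rpow_of_exponent_le h1 (by linarith)
      _ = _ := by rw [Real.rpow_neg (norm_nonneg _)]; norm_num

theorem multinomialMLTerm_eq_bromwich {n : ℕ} {α : Fin n → ℝ} {β c : ℝ} (hα : ∀ j, 0 < α j)
    (hβ : 0 < β) (hc : 1 ≤ c) (z : Fin n → ℂ) (k : ℕ) :
    multinomialMLTerm α β z k =
      bromwich c (iteratedDeriv 4 fun s => s ^ (-(β : ℂ)) * mlSum α z s ^ k) := by
  have hb (κ : Fin n → ℕ) : 0 < β + ∑ j, α j * (κ j : ℝ) :=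
    add_pos_of_pos_of_nonneg hβ
      (Finset.sum_nonneg fun j _ => mul_nonneg (hα j).le (Nat.cast_nonneg _))
  have hline (y : ℝ) :
      cexp (c + y * I) *
        iteratedDeriv 4 (fun s => s ^ (-(β : ℂ)) * mlSum α z s ^ k) (c + y * I) =
      ∑ κ ∈ Finset.piAntidiag (Finset.univ : Finset (Fin n)) k,
        ((Nat.multinomial Finset.univ κ : ℂ) * ∏ j, z j ^ κ j) * (cexp (c + y * I) *
          iteratedDeriv 4 (fun s : ℂ => s ^ (-((β + ∑ j, α j * (κ j : ℝ) : ℝ) : ℂ)))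
            (c + y * I)) := by
    have hs : (c + y * I : ℂ) ∈ slitPlane := Or.inl (by simp; linarith)
    have hd (κ : Fin n → ℕ) : ContDiffAt ℂ (4 : ℕ)
        (fun s : ℂ => s ^ (-((β + ∑ j, α j * (κ j : ℝ) : ℝ) : ℂ))) (c + y * I) :=
      (analyticAt_id.cpow analyticAt_const hs).contDiffAt
    have hev : (fun s => s ^ (-(β : ℂ)) * mlSum α z s ^ k) =ᶠ[𝓝 (c + y * I : ℂ)] fun s =>
        ∑ κ ∈ Finset.piAntidiag (Finset.univ : Finset (Fin n)) k,
          ((Nat.multinomial Finset.univ κ : ℂ) * ∏ j, z j ^ κ j) *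
            s ^ (-((β + ∑ j, α j * (κ j : ℝ) : ℝ) : ℂ)) := by
      filter_upwards [isOpen_ne.mem_nhds (slitPlane_ne_zero hs)] with s hs0
      exact cpow_neg_mul_mlSum_pow α β z k hs0
    rw [hev.iteratedDeriv_eq, iteratedDeriv_fun_sum fun κ _ => contDiffAt_const.mul (hd κ),
      Finset.mul_sum]
    refine Finset.sum_congr rfl fun κ _ => ?_
    rw [iteratedDeriv_const_mul _ (hd κ), mul_left_comm]
  rw [bromwich]
  simp only [hline]
  rw [integral_finsetSum _ fun κ _ =>
    (integrable_iteratedDeriv_cpow_neg (hb κ) hc).const_mul _, Finset.mul_sum, multinomialMLTerm]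
  refine Finset.sum_congr rfl fun κ _ => ?_
  rw [integral_const_mul, mul_left_comm, div_eq_mul_inv,
    ← bromwich_iteratedDeriv_cpow_neg (hb κ) hc, bromwich]

theorem exists_norm_mlSum_le {n : ℕ} {α : Fin n → ℝ} (hα : ∀ j, 0 < α j) (z : Fin n → ℂ) :
    ∃ R : ℝ, 1 ≤ R ∧ ∀ w : ℂ, R ≤ ‖w‖ → ‖mlSum α z w‖ ≤ 1 / 2 := by
  have h : Tendsto (fun r : ℝ => ∑ j, ‖z j‖ * r ^ (-α j)) atTop (𝓝 0) := by
    have := tendsto_finsetSum Finset.univ fun j (_ : j ∈ Finset.univ) =>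
      (tendsto_rpow_neg_atTop (hα j)).const_mul ‖z j‖
    simpa using this
  obtain ⟨R, hR⟩ := eventually_atTop.1 (h.eventually (eventually_le_nhds (by norm_num :
    (0 : ℝ) < 1 / 2)))
  refine ⟨max 1 R, le_max_left _ _, fun w hw => ?_⟩
  refine (norm_sum_le _ _).trans ?_
  simp only [norm_mul, norm_cpow_neg_ofReal]
  exact hR _ ((le_max_right _ _).trans hw)

theorem differentiableAt_mlSum {n : ℕ} (α : Fin n → ℝ) (z : Fin n → ℂ) {w : ℂ}
    (hw : w ∈ slitPlane) : DifferentiableAt ℂ (mlSum α z) w := by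
  unfold mlSum
  refine DifferentiableAt.fun_sum fun j _ => DifferentiableAt.const_mul ?_ _
  exact (analyticAt_id.cpow analyticAt_const hw).differentiableAt

theorem differentiableAt_remainder {n : ℕ} (α : Fin n → ℝ) (β : ℝ) (z : Fin n → ℂ) (k : ℕ) {w : ℂ}
    (hw : w ∈ slitPlane) (h : 1 - mlSum α z w ≠ 0) :
    DifferentiableAt ℂ (fun s => s ^ (-(β : ℂ)) * mlSum α z s ^ k / (1 - mlSum α z s)) w := by
  have hS := differentiableAt_mlSum α z hw
  refine DifferentiableAt.div (DifferentiableAt.mul ?_ (hS.pow k)) (hS.const_sub 1) h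
  exact (analyticAt_id.cpow analyticAt_const hw).differentiableAt

/-- The sum of the multinomial Mittag-Leffler series as a Bromwich integral over a line far to the
right, on which `|mlSum α z s| ≤ 1 / 2`. -/
theorem exists_summable_multinomialML_eq {n : ℕ} {α : Fin n → ℝ} {β θ ρ : ℝ} (hα : ∀ j, 0 < α j)
    (hβ : 0 < β) (hθ0 : 0 ≤ θ) (hθ : θ < Real.pi) (hρ : 0 < ρ)
    (hρ2 : ρ ≤ 1 / 2) (hρθ : 2 * ρ ≤ -Real.cos θ) (z : Fin n → ℂ) :
    ∃ c : ℝ, 1 ≤ c ∧ Summable (multinomialMLTerm α β z) ∧ multinomialML α β z =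
      bromwich c (iteratedDeriv 4 fun s => s ^ (-(β : ℂ)) / (1 - mlSum α z s)) := by
  obtain ⟨R, hR1, hR⟩ := exists_norm_mlSum_le hα z
  have hc : 1 ≤ 2 * R := by linarith
  set r : ℕ → ℂ → ℂ := fun k s => s ^ (-(β : ℂ)) * mlSum α z s ^ k / (1 - mlSum α z s) with hr
  have hgeom {w : ℂ} (hw : R ≤ ‖w‖) : 1 / 2 ≤ ‖1 - mlSum α z w‖ := by
    have := norm_sub_norm_le 1 (mlSum α z w)
    rw [norm_one] at this
    linarith [hR w hw]
  have hball {s w : ℂ} (hs : 2 * R ≤ s.re) (hw : w ∈ Metric.closedBall s (ρ * ‖s‖)) :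
      w ∈ slitPlane ∧ R ≤ ‖w‖ := by
    obtain ⟨h1, h2, -⟩ := abs_arg_le_of_mem_closedBall hθ0 hρ hρ2 hρθ (by linarith) hw
    have h3 : R ≤ ‖w‖ := by linarith [re_le_norm s]
    refine ⟨mem_slitPlane_iff_arg.2 ⟨fun h => ?_, norm_pos_iff.1 (by linarith)⟩, h3⟩
    rw [h, abs_of_pos Real.pi_pos] at h1
    linarith
  have hcontrol (k : ℕ) : ControlledNear ρ (2 * R) (2 * (1 / 2) ^ k) (r k) := by
    intro s hs w hw
    obtain ⟨hslit, hRw⟩ := hball hs hw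
    have hg := hgeom hRw
    refine ⟨differentiableAt_remainder α β z k hslit fun h => ?_, ?_⟩
    · rw [h, norm_zero] at hg
      linarith
    · have h1 : ‖w‖ ^ (-β) ≤ 1 := Real.rpow_le_one_of_one_le_of_nonpos (by linarith) (by linarith)
      have h2 : 1 ≤ ‖s‖ ^ 2 := one_le_pow₀ (by linarith [re_le_norm s])
      simp only [hr]
      rw [norm_div, norm_mul, norm_pow, norm_cpow_neg_ofReal, div_le_iff₀ (by linarith)]
      calc ‖w‖ ^ (-β) * ‖mlSum α z w‖ ^ k ≤ 1 * (1 / 2) ^ k := by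
            gcongr
            exact hR w hRw
        _ = 2 * (1 / 2) ^ k * 1 * (1 / 2) := by ring
        _ ≤ _ := by gcongr
  set b : ℕ → ℂ := fun k => bromwich (2 * R) (iteratedDeriv 4 (r k)) with hb
  have hterm (k : ℕ) : multinomialMLTerm α β z k = b k - b (k + 1) := by
    rw [multinomialMLTerm_eq_bromwich hα hβ hc z k]
    -- near the line, `S ^ k = S ^ k / (1 - S) - S ^ (k + 1) / (1 - S)` for `S = mlSum α z`
    refine (hcontrol k).bromwich_sub (hcontrol (k + 1)) hρ hc fun s hs => ?_
    have hpos : 0 < ρ * ‖s‖ := mul_pos hρ (norm_pos_iff.2 (ne_zero_of_le_re hc hs.ge))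
    filter_upwards [Metric.closedBall_mem_nhds s hpos] with w hw
    have hg := hgeom (hball hs.ge hw).2
    have hne : 1 - mlSum α z w ≠ 0 := fun h => by
      rw [h, norm_zero] at hg
      linarith
    simp only [hr, Pi.sub_apply]
    field_simp
    ring
  set M : ℝ := Real.exp (2 * R) * (24 * 2 / ρ ^ 4) / 2 with hM
  have hbk (k : ℕ) : ‖b k‖ ≤ M * (1 / 2) ^ k := by
    refine ((hcontrol k).norm_bromwich_le hρ hc).trans (le_of_eq ?_)
    rw [hM]
    ring
  have hsum : Summable b :=
    Summable.of_norm_bounded ((summable_geometric_two).mul_left M) hbk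
  have hsum' : Summable (multinomialMLTerm α β z) := by
    have := hsum.sub ((summable_nat_add_iff 1).2 hsum)
    exact this.congr fun k => (hterm k).symm
  refine ⟨2 * R, hc, hsum', ?_⟩
  have hlim : HasSum (multinomialMLTerm α β z) (b 0) := by
    rw [hsum'.hasSum_iff_tendsto_nat]
    have h := hsum.tendsto_atTop_zero.const_sub (b 0)
    rw [sub_zero] at h
    refine h.congr fun n => ?_
    rw [Finset.sum_congr rfl fun k _ => hterm k, Finset.sum_range_sub']
  rw [multinomialML, hlim.tsum_eq]
  simp only [hb, hr, pow_zero, mul_one]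

/-! ### The decay estimate -/

theorem mainTheorem3 (m : ℕ) (α : Fin (m + 1) → ℝ) (β μ K : ℝ)
    (hβ : 0 < β)
    (hα_anti : StrictAnti α) (hα_pos : ∀ j, 0 < α j) (hα_two : α 0 < 2)
    (hμ_lower : α 0 * Real.pi / 2 < μ) (hμ_upper : μ < min (α 0 * Real.pi) Real.pi)
    (hK : 0 < K) :
    ∃ C : ℝ, 0 < C ∧ ∀ z : Fin (m + 1) → ℂ,
      z 0 ≠ 0 →
      μ ≤ |Complex.arg (z 0)| → |Complex.arg (z 0)| ≤ Real.pi →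
      (∀ j, j ≠ 0 → ∃ x : ℝ, z j = (x : ℂ) ∧ -K ≤ x ∧ x < 0) →
        Summable (multinomialMLTerm α β z) ∧
        ‖multinomialML α β z‖ ≤ C / (1 + ‖z 0‖) := by
  have hπ := Real.pi_pos
  have hα0 := hα_pos 0
  have hμπ : μ < Real.pi := hμ_upper.trans_le (min_le_right _ _)
  have hμα : μ < α 0 * Real.pi := hμ_upper.trans_le (min_le_left _ _)
  -- an angle `θ` with `π / 2 < θ < π` and `α 0 * θ < μ`
  obtain ⟨θ, hθ1, hθ2⟩ : ∃ θ, Real.pi / 2 < θ ∧ θ < μ / α 0 := by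
    refine exists_between ?_
    rw [lt_div_iff₀ hα0]
    linarith
  have hθμ : α 0 * θ < μ := by rwa [lt_div_iff₀ hα0, mul_comm] at hθ2
  have hθπ : θ < Real.pi := hθ2.trans (by rwa [div_lt_iff₀ hα0, mul_comm])
  have hθ0 : 0 ≤ θ := by linarith
  have hcosθ : Real.cos θ < 0 := Real.cos_neg_of_pi_div_two_lt_of_lt hθ1 (by linarith)
  obtain ⟨ρ, hρ, hρ2, hρθ⟩ : ∃ ρ : ℝ, 0 < ρ ∧ ρ ≤ 1 / 2 ∧ 2 * ρ ≤ -Real.cos θ :=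
    ⟨-Real.cos θ / 2, by linarith, by linarith [Real.neg_one_le_cos θ], by linarith⟩
  set κ : ℝ := Real.cos ((Real.pi - (μ - α 0 * θ)) / 2) with hκ
  have hκ0 : 0 < κ := by
    refine Real.cos_pos_of_mem_Ioo ⟨?_, by linarith⟩
    have : 0 ≤ α 0 * θ := mul_nonneg hα0.le hθ0
    linarith
  refine ⟨Real.exp 1 * (24 * (4 * 2 ^ β / κ) / ρ ^ 4) / 2, by positivity, fun z _ hz0 _ hz => ?_⟩
  obtain ⟨c, hc, hsum, hint⟩ :=
    exists_summable_multinomialML_eq hα_pos hβ hθ0 hθπ hρ hρ2 hρθ z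
  refine ⟨hsum, ?_⟩
  have hcontrol : ControlledNear ρ 1 (4 * 2 ^ β / κ / (1 + ‖z 0‖))
      (fun s => s ^ (-(β : ℂ)) / (1 - mlSum α z s)) := by
    intro s hs w hw
    obtain ⟨harg, hw1, hw2⟩ := abs_arg_le_of_mem_closedBall hθ0 hρ hρ2 hρθ (by linarith) hw
    have hs1 : 1 ≤ ‖s‖ := hs.trans (re_le_norm s)
    have hw0 : 0 < ‖w‖ := by linarith
    have hslit : w ∈ slitPlane := by
      refine mem_slitPlane_iff_arg.2 ⟨fun h => ?_, norm_pos_iff.1 hw0⟩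
      rw [h, abs_of_pos hπ] at harg
      linarith
    have hlow := le_norm_one_sub_mlSum (fun j => hα_anti.antitone (Fin.zero_le j)) hα_pos hθμ hμπ
      hz0 (fun j hj => (hz j hj).imp fun x hx => ⟨hx.1, hx.2.2⟩) harg
    rw [← hκ] at hlow
    have hpos : 0 < κ * (1 + ‖z 0‖ * ‖w‖ ^ (-α 0)) := by positivity
    constructor
    · have h := differentiableAt_remainder α β z 0 hslit
        (norm_pos_iff.1 (hpos.trans_le hlow))
      simpa only [pow_zero, mul_one] using h
    -- the bound uses `|s| / 2 ≤ |w| ≤ 2|s|`, `1 ≤ |s|` and `α 0 < 2`; the factor `|s| ^ 2` absorbs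
    -- the power of `|w|` lost in passing from `|w| ^ (-α 0) * |z 0|` to `|z 0|`
    · have hβw : ‖w‖ ^ (-β) ≤ 2 ^ β := by
        calc ‖w‖ ^ (-β) ≤ (1 / 2 : ℝ) ^ (-β) :=
              Real.rpow_le_rpow_of_nonpos (by norm_num) (by linarith) (by linarith)
          _ = 2 ^ β := by rw [one_div, Real.inv_rpow zero_le_two, Real.rpow_neg zero_le_two, inv_inv]
      have hαw : 1 ≤ 4 * ‖s‖ ^ 2 * ‖w‖ ^ (-α 0) := by
        have h1 : ‖w‖ ^ α 0 ≤ (2 * ‖s‖) ^ (2 : ℝ) :=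
          (Real.rpow_le_rpow hw0.le hw2 hα0.le).trans
            (Real.rpow_le_rpow_of_exponent_le (by linarith) hα_two.le)
        rw [Real.rpow_two] at h1
        rw [Real.rpow_neg hw0.le, ← div_eq_mul_inv, one_le_div (by positivity)]
        linarith
      have hz1 : 1 + ‖z 0‖ ≤ 4 * ‖s‖ ^ 2 * (1 + ‖z 0‖ * ‖w‖ ^ (-α 0)) := by
        have h1 := mul_le_mul_of_nonneg_left hαw (norm_nonneg (z 0))
        have h2 : 1 ≤ ‖s‖ ^ 2 := one_le_pow₀ hs1
        linarith
      rw [norm_div, norm_cpow_neg_ofReal, div_le_iff₀ (hpos.trans_le hlow)]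
      calc ‖w‖ ^ (-β) ≤ 2 ^ β := hβw
        _ ≤ 2 ^ β * (4 * ‖s‖ ^ 2 * (1 + ‖z 0‖ * ‖w‖ ^ (-α 0)) / (1 + ‖z 0‖)) := by
          refine le_mul_of_one_le_right (by positivity) ?_
          rwa [one_le_div (by positivity)]
        _ = 4 * 2 ^ β / κ / (1 + ‖z 0‖) * ‖s‖ ^ 2 * (κ * (1 + ‖z 0‖ * ‖w‖ ^ (-α 0))) := by
          field_simp
        _ ≤ _ := by gcongr
  rw [hint, hcontrol.bromwich_eq_bromwich_one hρ hc]
  refine (hcontrol.norm_bromwich_le hρ le_rfl).trans (le_of_eq ?_)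
  field_simp
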